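/- Let $T$ be a finite tree. Then $\dim_{\mathrm{poc}}(T)\le 3$, and equality holds if and only if $T$ is not a caterpillar. Here, for $d\ge 1$ and $\mathbf{x},\mathbf{y}\in\mathbb{R}^d$, write $\mathbf{x}\prec\mathbf{y}$ if $x_i<y_i$ for all $i=1,\dots,d$. A $d$-partial order is a digraph isomorphic to the digraph $D_S$ of some finite set $S\subseteq\mathbb{R}^d$, where $D_S$ has vertex set $S$ and arc set $\{(\mathbf{x},\mathbf{v}) : \mathbf{v},\mathbf{x}\in S,\ \mathbf{v}\prec\mathbf{x}\}$; a $0$-partial order is a digraph with exactly one vertex. The competition graph of a digraph $D$ has the same vertex set as $D$, and two distinct vertices $x,y$ are adjacent in it if and only if there is a vertex $z$ such that $(x,z)$ and $(y,z)$ are arcs of $D$. The partial order competition dimension $\dim_{\mathrm{poc}}(G)$ of a finite graph $G$ is the smallest integer $d\ge 0$ such that, for some integer $k\ge 0$, $G$ together with $k$ additional isolated vertices is the competition graph of some $d$-partial order. A caterpillar is a tree containing a path (possibly consisting of a single vertex) such that every vertex of the tree lies on the path or is adjacent to a vertex of the path. -/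

import Mathlib

/-- The competition graph `C(D)` of a digraph `D`: two distinct vertices `x`, `y` are adjacent iff
there is a vertex `z` such that `(x, z)` and `(y, z)` are arcs of `D`. -/
def competitionGraph {V : Type*} (D : Digraph V) : SimpleGraph V where
  Adj x y := x ≠ y ∧ ∃ z, D.Adj x z ∧ D.Adj y z
  symm := ⟨fun _ _ h => ⟨h.1.symm, h.2.imp fun _ hz => ⟨hz.2, hz.1⟩⟩⟩
  loopless := ⟨fun _ h => h.1 rfl⟩

/-- The digraph `D_S` of a finite set `S ⊆ ℝ^d`: its vertices are the points of `S`, and `(x, v)` is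
an arc iff `v ≺ x`, that is, `v i < x i` for every coordinate `i`. -/
def pointDigraph {d : ℕ} (S : Finset (Fin d → ℝ)) : Digraph S where
  Adj x v := ∀ i, (v : Fin d → ℝ) i < (x : Fin d → ℝ) i

/-- `D` is a `d`-partial order. For `d = 0` this means by convention that `D` has exactly one vertex;
for `d ≥ 1` it means that `D` is isomorphic to `D_S` for some finite `S ⊆ ℝ^d`. -/
def IsDPartialOrder {V : Type*} (d : ℕ) (D : Digraph V) : Prop :=
  if d = 0 then Nat.card V = 1
  else ∃ S : Finset (Fin d → ℝ), Nonempty (D.Adj ≃r (pointDigraph S).Adj)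

/-- `G` together with `k` isolated vertices, for some `k`, is the competition graph of a
`d`-partial order. -/
def IsPocRealizable {V : Type*} (G : SimpleGraph V) (d : ℕ) : Prop :=
  ∃ (k : ℕ) (D : Digraph (V ⊕ Fin k)),
    IsDPartialOrder d D ∧ G.sum (⊥ : SimpleGraph (Fin k)) = competitionGraph D

/-- The partial order competition dimension of `G`: the smallest `d` such that `G` together with some
isolated vertices is the competition graph of a `d`-partial order. It is taken in `ℕ∞`, so that it
would be `⊤` (and not a junk natural number) if there were no such `d`. -/
noncomputable def dimPoc {V : Type*} (G : SimpleGraph V) : ℕ∞ :=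
  ⨅ d ∈ {d : ℕ | IsPocRealizable G d}, (d : ℕ∞)

/-- A caterpillar is a tree that has a path such that every vertex lies on the path or is adjacent
to a vertex of the path. -/
def IsCaterpillar {V : Type*} (G : SimpleGraph V) : Prop :=
  G.IsTree ∧ ∃ (u v : V) (p : G.Walk u v), p.IsPath ∧
    ∀ w, ∃ x ∈ p.support, w = x ∨ G.Adj w x

/-!
Say that `z` is a *prey* of `x` when `z ≺ x`, so that adjacency in a competition graph means having
a common prey.

**Realizing a graph.** It suffices to give points `p v`, one for each vertex, and a finite antichain
`Q` (for `≺`) of candidate prey such that two vertices are adjacent iff some `q ∈ Q` lies below both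
(`isPocRealizable_of_points`). The points of `Q` become the isolated vertices.

**Trees in dimension three.** Growing a tree leaf by leaf, let `f` be a linear order in which each
new leaf is inserted directly above its neighbour, and let `g` put each new leaf at the bottom. For
every edge `uv` and every other vertex `w`, either `w` is outside the `f`-interval between `u` and
`v`, or `w` is below both in `g` (`SimpleGraph.IsTree.exists_edge_separating_labels`): when the edge
appears, no vertex is between its ends, and every later vertex is below both ends in `g`. With
`p v = (f v, -f v, g v)`, the point just under the coordinatewise minimum of `p u` and `p v` is
therefore below `p u` and `p v` only.

**Caterpillars in dimension two.** The antidiagonal points `(t, -t)` below `(r + 1, 1 - l)` are those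
with `l ≤ t ≤ r`, so intersection graphs of intervals are realizable in the plane. A caterpillar is
such a graph: spine vertices get consecutive intervals, and the remaining vertices get distinct
points in the intervals of their neighbours. That the intersection graph has no *missing* edges
follows without case analysis from the fact that a tree is a minimal connected graph.

**Non-caterpillars in dimension at most two.** In the plane, order the minimal points by `x₀ - x₁`.
The minimal prey of a given point are consecutive, hence the competition graph is an interval graph
(`IsPocRealizable.isIntervalGraph`). The same function gives the case of dimension one. An interval
graph has no asteroidal triple, in particular no induced subdivided claw
(`IsIntervalGraph.not_subdividedClaw`), whereas a vertex at distance two from a longest path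
of a tree yields one (`SimpleGraph.IsTree.exists_subdividedClaw`).
-/

/-! ### Realization by points over an antichain -/

/-- A sufficient condition for realizability: the vertices are placed at the points `p v`, the
isolated vertices at the points of an antichain `Q`, and adjacency is having a common lower bound in
`Q`. A relation `p u ≺ p v` does no harm, since a point of `Q` below `p u` is below `p v` as well. -/
theorem isPocRealizable_of_points {V : Type*} [Finite V] {G : SimpleGraph V} {d : ℕ} (hd : d ≠ 0)
    (p : V → Fin d → ℝ) (hp : Function.Injective p) (Q : Finset (Fin d → ℝ))
    (hQ : ∀ q ∈ Q, ∀ q' ∈ Q, ¬ ∀ i, q i < q' i)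
    (hne : ∀ v, ∃ q ∈ Q, ∀ i, q i < p v i)
    (hadj : ∀ u v, u ≠ v → (G.Adj u v ↔ ∃ q ∈ Q, (∀ i, q i < p u i) ∧ ∀ i, q i < p v i)) :
    IsPocRealizable G d := by
  have hpQ : ∀ v, ∀ q ∈ Q, ¬ ∀ i, p v i < q i := fun v q hq h => by
    obtain ⟨q', hq', h'⟩ := hne v
    exact hQ q' hq' q hq fun i => (h' i).trans (h i)
  let φ : V ⊕ Fin Q.card → Fin d → ℝ := Sum.elim p fun j => (Q.equivFin.symm j : Fin d → ℝ)
  have hφr : ∀ j, φ (Sum.inr j) ∈ Q := fun j => (Q.equivFin.symm j).2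
  have hφ : Function.Injective φ := by
    refine hp.sumElim (Subtype.val_injective.comp Q.equivFin.symm.injective) fun v j h => ?_
    obtain ⟨q, hq, hqv⟩ := hne v
    exact hQ q hq _ (hφr j) fun i => (hqv i).trans_eq (congrFun h i)
  have hbot : ∀ j z, ¬ ∀ i, φ z i < φ (Sum.inr j) i := by
    rintro j (v | j') h
    · exact hpQ v _ (hφr j) h
    · exact hQ _ (hφr j') _ (hφr j) h
  refine ⟨Q.card, ⟨fun x z => ∀ i, φ z i < φ x i⟩, ?_, ?_⟩
  · rw [IsDPartialOrder, if_neg hd]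
    refine ⟨(Set.finite_range φ).toFinset, ⟨⟨(Equiv.ofInjective φ hφ).trans
      (Equiv.subtypeEquivRight fun x => by simp), ?_⟩⟩⟩
    rfl
  · ext x y
    rcases x with u | j
    · rcases y with v | j
      · simp only [SimpleGraph.sum_adj_inl, competitionGraph]
        constructor
        · intro h
          obtain ⟨q, hq, hu, hv⟩ := (hadj u v h.ne).1 h
          refine ⟨Sum.inl_injective.ne h.ne, Sum.inr (Q.equivFin ⟨q, hq⟩), ?_, ?_⟩ <;>
            simpa [φ]
        · rintro ⟨huv, z, hzu, hzv⟩
          refine (hadj u v (fun h => huv (congrArg _ h))).2 ?_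
          rcases z with w | j
          · obtain ⟨q, hq, hw⟩ := hne w
            exact ⟨q, hq, fun i => (hw i).trans (hzu i), fun i => (hw i).trans (hzv i)⟩
          · exact ⟨_, hφr j, hzu, hzv⟩
      · refine iff_of_false (by simp) ?_
        rintro ⟨-, z, -, h⟩
        exact hbot j z h
    · refine iff_of_false (by rcases y with v | j' <;> simp) ?_
      rintro ⟨-, z, h, -⟩
      exact hbot j z h

/-! ### Trees in dimension three -/

/-- Every finite tree has labels `f` and `g` such that, for each edge `uv` and each further vertex
`w`, either `f w` is not between `f u` and `f v`, or `g w` is below both `g u` and `g v`. -/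
theorem SimpleGraph.IsTree.exists_edge_separating_labels {V : Type*} [Finite V] {T : SimpleGraph V}
    (hT : T.IsTree) : ∃ (f : V → ℤ) (g : V → ℕ), Function.Injective f ∧
      ∀ u v w, T.Adj u v → w ≠ u → w ≠ v →
        (f w < f u ∧ f w < f v) ∨ (f u < f w ∧ f v < f w) ∨ (g w < g u ∧ g w < g v) := by
  classical
  induction hn : Nat.card V generalizing V with
  | zero =>
    have := hT.connected.nonempty
    exact absurd hn Nat.card_pos.ne'
  | succ n ih =>
    rcases subsingleton_or_nontrivial V with _ | _
    · exact ⟨fun _ => 0, fun _ => 0, Function.injective_of_subsingleton _,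
        fun u v w h _ _ => absurd (Subsingleton.elim u v) h.ne⟩
    have := Fintype.ofFinite V
    obtain ⟨x, hx⟩ := hT.exists_vert_degree_one_of_nontrivial
    have hconn := hT.connected.induce_compl_singleton_of_degree_eq_one hx
    obtain ⟨a, hxa, ha⟩ := SimpleGraph.degree_eq_one_iff_existsUnique_adj.1 hx
    have hcard : Nat.card ({x}ᶜ : Set V) = n := by
      have h := Set.ncard_add_ncard_compl ({x} : Set V)
      rw [Set.ncard_singleton, hn] at h
      rw [Nat.card_coe_set_eq]
      omega
    obtain ⟨f, g, hf, hfg⟩ := ih ⟨hconn, hT.isAcyclic.induce _⟩ hcard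
    have hax : a ≠ x := hxa.ne'
    -- The labels `f` are doubled to make room for the leaf `x` directly above its neighbour `a`.
    let f' : V → ℤ := fun w => if h : w = x then 2 * f ⟨a, hax⟩ + 1 else 2 * f ⟨w, h⟩
    let g' : V → ℕ := fun w => if h : w = x then 0 else g ⟨w, h⟩ + 1
    have f'x : f' x = 2 * f ⟨a, hax⟩ + 1 := dif_pos rfl
    have g'x : g' x = 0 := dif_pos rfl
    have f'o : ∀ w (h : w ≠ x), f' w = 2 * f ⟨w, h⟩ := fun w h => dif_neg h
    have g'o : ∀ w (h : w ≠ x), g' w = g ⟨w, h⟩ + 1 := fun w h => dif_neg h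
    have hleaf : ∀ w, w ≠ x → w ≠ a →
        (f' w < f' x ∧ f' w < f' a) ∨ (f' x < f' w ∧ f' a < f' w) := by
      intro w hwx hwa
      have : f ⟨w, hwx⟩ ≠ f ⟨a, hax⟩ := fun h => hwa (congrArg Subtype.val (hf h))
      rw [f'x, f'o w hwx, f'o a hax]
      omega
    refine ⟨f', g', ?_, ?_⟩
    · intro u v huv
      by_cases hu : u = x <;> by_cases hv : v = x
      · rw [hu, hv]
      · rw [hu, f'x, f'o v hv] at huv
        omega
      · rw [hv, f'x, f'o u hu] at huv
        omega
      · rw [f'o u hu, f'o v hv] at huv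
        exact congrArg Subtype.val (hf (by omega : f ⟨u, hu⟩ = f ⟨v, hv⟩))
    · intro u v w huv hwu hwv
      by_cases hu : u = x
      · subst hu
        obtain rfl := ha v huv
        have := hleaf w hwu hwv
        tauto
      by_cases hv : v = x
      · subst hv
        obtain rfl := ha u huv.symm
        have := hleaf w hwv hwu
        tauto
      rw [f'o u hu, f'o v hv, g'o u hu, g'o v hv]
      by_cases hw : w = x
      · rw [hw, g'x]
        omega
      · rw [f'o w hw, g'o w hw]
        have := hfg ⟨u, hu⟩ ⟨v, hv⟩ ⟨w, hw⟩ huv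
          (fun h => hwu (congrArg Subtype.val h)) fun h => hwv (congrArg Subtype.val h)
        omega

theorem SimpleGraph.IsTree.isPocRealizable_three {V : Type*} [Finite V] {T : SimpleGraph V}
    (hT : T.IsTree) : IsPocRealizable T 3 := by
  classical
  have := Fintype.ofFinite V
  obtain ⟨f, g, hf, hfg⟩ := hT.exists_edge_separating_labels
  let p : V → Fin 3 → ℝ := fun v => ![((f v : ℤ) : ℝ), ((-f v : ℤ) : ℝ), (((g v : ℕ) : ℤ) : ℝ)]
  let q : V × V → Fin 3 → ℝ := fun e => ![((min (f e.1) (f e.2) - 1 : ℤ) : ℝ),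
    ((min (-f e.1) (-f e.2) - 1 : ℤ) : ℝ), ((min (g e.1 : ℤ) (g e.2) - 1 : ℤ) : ℝ)]
  have hqp : ∀ e w, (∀ i, q e i < p w i) ↔ min (f e.1) (f e.2) - 1 < f w ∧
      min (-f e.1) (-f e.2) - 1 < -f w ∧ min (g e.1 : ℤ) (g e.2) - 1 < g w := by
    intro e w
    simp only [Fin.forall_fin_succ, q, p, Matrix.cons_val_zero, Matrix.cons_val_succ, Int.cast_lt]
    simp
  -- The diagonal pairs provide a prey for each vertex, even if the tree has no edge.
  let E : Finset (V × V) := Finset.univ.filter fun e => e.1 = e.2 ∨ T.Adj e.1 e.2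
  have hE : ∀ e ∈ E, ∀ w, (∀ i, q e i < p w i) → w = e.1 ∨ w = e.2 := by
    intro e he w h
    rw [hqp] at h
    rcases (Finset.mem_filter.1 he).2 with h' | h'
    · left
      rw [← h'] at h
      exact hf (by omega)
    · by_contra! hw
      have := hfg e.1 e.2 w h' hw.1 hw.2
      omega
  refine isPocRealizable_of_points three_ne_zero p ?_ (E.image q) ?_ ?_ ?_
  · intro u v h
    exact hf (Int.cast_injective (α := ℝ) (congrFun h 0))
  · intro x hx y hy h
    obtain ⟨e, he, rfl⟩ := Finset.mem_image.1 hx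
    obtain ⟨e', -, rfl⟩ := Finset.mem_image.1 hy
    have h0 : min (f e.1) (f e.2) - 1 < min (f e'.1) (f e'.2) - 1 :=
      Int.cast_lt.1 (h 0)
    have h1 : min (-f e.1) (-f e.2) - 1 < min (-f e'.1) (-f e'.2) - 1 :=
      Int.cast_lt.1 (h 1)
    have h2 : min (g e.1 : ℤ) (g e.2) - 1 < min (g e'.1 : ℤ) (g e'.2) - 1 :=
      Int.cast_lt.1 (h 2)
    -- The first two coordinates put the label of `e'.1` strictly between those of `e.1` and `e.2`.
    rcases hE e he e'.1 ((hqp _ _).2 (by omega)) with h' | h' <;> rw [h'] at h0 h1 <;> omega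
  · intro v
    exact ⟨q (v, v), Finset.mem_image_of_mem _ (by simp [E]), (hqp _ _).2 (by simp)⟩
  · intro u v huv
    constructor
    · intro h
      refine ⟨q (u, v), Finset.mem_image_of_mem _ (by simp [E, h]), ?_, ?_⟩ <;>
        rw [hqp] <;> dsimp only <;> omega
    · rintro ⟨_, hx, hu, hv⟩
      obtain ⟨e, he, rfl⟩ := Finset.mem_image.1 hx
      have he' := (Finset.mem_filter.1 he).2
      have hu' := hE e he u hu
      have hv' := hE e he v hv
      grind [SimpleGraph.adj_comm]

/-! ### Caterpillars in dimension two -/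

/-- The intersection graph of distinct intervals `[l v, r v]` is realizable in the plane. -/
theorem isPocRealizable_two_of_intervals {V : Type*} [Finite V] {G : SimpleGraph V} (l r : V → ℤ)
    (hlr : ∀ v, l v ≤ r v) (hinj : ∀ u v, l u = l v → r u = r v → u = v)
    (hadj : ∀ u v, u ≠ v → (G.Adj u v ↔ l u ≤ r v ∧ l v ≤ r u)) : IsPocRealizable G 2 := by
  classical
  have := Fintype.ofFinite V
  let p : V → Fin 2 → ℝ := fun v => ![((r v + 1 : ℤ) : ℝ), ((1 - l v : ℤ) : ℝ)]
  let q : V → Fin 2 → ℝ := fun v => ![((l v : ℤ) : ℝ), ((- l v : ℤ) : ℝ)]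
  have hqp : ∀ v w, (∀ i, q v i < p w i) ↔ l w ≤ l v ∧ l v ≤ r w := by
    intro v w
    rw [Fin.forall_fin_two]
    simp only [q, p, Matrix.cons_val_zero, Matrix.cons_val_one, Int.cast_lt]
    omega
  refine isPocRealizable_of_points two_ne_zero p ?_ (Finset.univ.image q) ?_ ?_ ?_
  · intro u v h
    have h0 : r u + 1 = r v + 1 := Int.cast_injective (α := ℝ) (congrFun h 0)
    have h1 : 1 - l u = 1 - l v := Int.cast_injective (α := ℝ) (congrFun h 1)
    exact hinj u v (by omega) (by omega)
  · intro x hx y hy h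
    obtain ⟨v, -, rfl⟩ := Finset.mem_image.1 hx
    obtain ⟨w, -, rfl⟩ := Finset.mem_image.1 hy
    have h0 : l v < l w := Int.cast_lt.1 (h 0)
    have h1 : -l v < -l w := Int.cast_lt.1 (h 1)
    omega
  · intro v
    exact ⟨q v, Finset.mem_image_of_mem _ (Finset.mem_univ _), (hqp _ _).2 ⟨le_rfl, hlr v⟩⟩
  · intro u v huv
    rw [hadj u v huv]
    have := hlr u
    have := hlr v
    constructor
    · -- Two intersecting intervals share the larger of their left endpoints.
      rintro ⟨h1, h2⟩
      rcases le_total (l u) (l v) with h | h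
      · exact ⟨q v, Finset.mem_image_of_mem _ (Finset.mem_univ _), (hqp _ _).2 (by omega),
          (hqp _ _).2 (by omega)⟩
      · exact ⟨q u, Finset.mem_image_of_mem _ (Finset.mem_univ _), (hqp _ _).2 (by omega),
          (hqp _ _).2 (by omega)⟩
    · rintro ⟨_, hx, hu, hv⟩
      obtain ⟨w, -, rfl⟩ := Finset.mem_image.1 hx
      rw [hqp] at hu hv
      omega

theorem IsCaterpillar.isPocRealizable_two {V : Type*} [Finite V] {T : SimpleGraph V}
    (hT : IsCaterpillar T) : IsPocRealizable T 2 := by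
  classical
  obtain ⟨htree, a, b, p, hp, hdom⟩ := hT
  have hidx : ∀ w, ∃ i, i ≤ p.length ∧ (w ∈ p.support → p.getVert i = w) ∧
      (w ∉ p.support → T.Adj w (p.getVert i)) := by
    intro w
    by_cases hw : w ∈ p.support
    · obtain ⟨i, hi, hle⟩ := SimpleGraph.Walk.mem_support_iff_exists_getVert.1 hw
      exact ⟨i, hle, fun _ => hi, fun h => absurd hw h⟩
    · obtain ⟨x, hx, hwx⟩ := hdom w
      obtain ⟨i, rfl, hle⟩ := SimpleGraph.Walk.mem_support_iff_exists_getVert.1 hx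
      exact ⟨i, hle, fun h => absurd h hw, fun _ => hwx.resolve_left fun h => hw (h ▸ hx)⟩
  choose s hs hspine hleaf using hidx
  -- The offsets `1 ≤ c w < N` separate the vertices off the spine from each other and from the
  -- endpoints `i * N` of the intervals of the spine.
  obtain ⟨N, c, hcinj, hc1, hcN⟩ : ∃ (N : ℤ) (c : V → ℤ), Function.Injective c ∧
      (∀ w, 1 ≤ c w) ∧ ∀ w, c w < N := by
    let e := Finite.equivFin V
    refine ⟨Nat.card V + 1, fun w => (e w : ℕ) + 1, fun u v h => e.injective (Fin.ext ?_),
      fun w => ?_, fun w => ?_⟩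
    · dsimp only at h
      omega
    · dsimp only
      omega
    · have := (e w).2
      dsimp only
      omega
  let l : V → ℤ := fun w => s w * N + if w ∈ p.support then 0 else c w
  let r : V → ℤ := fun w => s w * N + if w ∈ p.support then N else c w
  have hlS : ∀ w ∈ p.support, l w = s w * N := fun w h => by simp [l, h]
  have hrS : ∀ w ∈ p.support, r w = (s w + 1) * N := fun w h => by simp [r, h, add_mul]
  have hlL : ∀ w ∉ p.support, l w = s w * N + c w := fun w h => by simp [l, h]
  have hrL : ∀ w ∉ p.support, r w = s w * N + c w := fun w h => by simp [r, h]
  have hN : 0 < N := by linarith [hc1 a, hcN a]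
  have hdiv : ∀ {i j x y : ℤ}, 0 ≤ x → y < N → i * N + x ≤ j * N + y → i ≤ j := by
    intro i j x y hx hy h
    by_contra! hij
    nlinarith
  have hlr : ∀ w, l w ≤ r w := by
    intro w
    by_cases hw : w ∈ p.support
    · rw [hlS w hw, hrS w hw]
      nlinarith
    · rw [hlL w hw, hrL w hw]
  have hadj_spine : ∀ u ∈ p.support, ∀ v ∈ p.support, u ≠ v → l v ≤ r u → s u ≤ s v →
      T.Adj u v := by
    intro u hu v hv huv h hle
    rw [hlS v hv, hrS u hu] at h
    have h1 : (s v : ℤ) ≤ s u + 1 := le_of_mul_le_mul_right h hN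
    have h2 : s u ≠ s v := fun h => huv (by rw [← hspine u hu, ← hspine v hv, h])
    have h3 : s v = s u + 1 := by omega
    rw [← hspine u hu, ← hspine v hv, h3]
    exact p.adj_getVert_succ (by have := hs v; omega)
  have hadj_leaf : ∀ u ∈ p.support, ∀ v ∉ p.support, l u ≤ r v → l v ≤ r u → T.Adj u v := by
    intro u hu v hv h1 h2
    rw [hlS u hu, hrL v hv] at h1
    rw [hlL v hv, hrS u hu] at h2
    have h3 : (s u : ℤ) ≤ s v := hdiv le_rfl (hcN v) (by linarith)
    have h4 : (s v : ℤ) < s u + 1 := lt_of_mul_lt_mul_right (by linarith [hc1 v]) hN.le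
    have h5 : s v = s u := by omega
    have h6 := hleaf v hv
    rw [h5, hspine u hu] at h6
    exact h6.symm
  let H : SimpleGraph V :=
    { Adj := fun u v => u ≠ v ∧ l u ≤ r v ∧ l v ≤ r u
      symm := ⟨fun _ _ h => ⟨h.1.symm, h.2.2, h.2.1⟩⟩
      loopless := ⟨fun _ h => h.1 rfl⟩ }
  have hHT : H ≤ T := by
    rintro u v ⟨huv, h1, h2⟩
    by_cases hu : u ∈ p.support <;> by_cases hv : v ∈ p.support
    · rcases le_total (s u) (s v) with h | h
      · exact hadj_spine u hu v hv huv h2 h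
      · exact (hadj_spine v hv u hu huv.symm h1 h).symm
    · exact hadj_leaf u hu v hv h1 h2
    · exact (hadj_leaf v hv u hu h2 h1).symm
    · rw [hlL u hu, hrL v hv] at h1
      rw [hlL v hv, hrL u hu] at h2
      have h3 : (s u : ℤ) ≤ s v := hdiv (by linarith [hc1 u]) (hcN v) h1
      have h4 : (s v : ℤ) ≤ s u := hdiv (by linarith [hc1 v]) (hcN u) h2
      rw [le_antisymm h3 h4] at h1 h2
      exact absurd (hcinj (by linarith)) huv
  have hsupp : ∀ i, p.getVert i ∈ p.support := fun i => p.getVert_mem_support i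
  have hsget : ∀ i ≤ p.length, s (p.getVert i) = i := fun i hi =>
    hp.getVert_injOn (hs _) hi (hspine _ (hsupp i))
  have hreach : ∀ i ≤ p.length, H.Reachable (p.getVert 0) (p.getVert i) := by
    intro i
    induction i with
    | zero => exact fun _ => .rfl
    | succ i ih =>
      intro hi
      refine (ih (by omega)).trans (SimpleGraph.Adj.reachable ⟨?_, ?_, ?_⟩)
      · exact (p.adj_getVert_succ hi).ne
      · rw [hlS _ (hsupp _), hrS _ (hsupp _), hsget _ hi, hsget _ (by omega)]
        push_cast
        nlinarith
      · rw [hlS _ (hsupp _), hrS _ (hsupp _), hsget _ hi, hsget _ (by omega)]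
        push_cast
        nlinarith
  have hroot : ∀ w, H.Reachable (p.getVert 0) w := by
    intro w
    have h := hreach (s w) (hs w)
    by_cases hw : w ∈ p.support
    · rwa [hspine w hw] at h
    · refine h.trans (SimpleGraph.Adj.reachable ⟨(hleaf w hw).ne', ?_, ?_⟩)
      · rw [hlS _ (hsupp _), hrL w hw, hsget _ (hs w)]
        linarith [hc1 w]
      · rw [hrS _ (hsupp _), hlL w hw, hsget _ (hs w)]
        linarith [hcN w]
  have hHconn : H.Connected :=
    (SimpleGraph.connected_iff_exists_forall_reachable H).2 ⟨p.getVert 0, hroot⟩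
  -- A tree is a minimal connected graph, so the connected subgraph `H` is all of `T`.
  have hTH : T ≤ H := (SimpleGraph.isTree_iff_minimal_connected.1 htree).2 hHconn hHT
  refine isPocRealizable_two_of_intervals l r hlr ?_ fun u v huv =>
    ⟨fun h => (hTH h).2, fun h => hHT ⟨huv, h⟩⟩
  intro u v h1 h2
  by_contra huv
  -- Vertices with equal intervals are adjacent, and the two kinds of intervals differ in length.
  have hA := hHT ⟨huv, h1.trans_le (hlr v), h1.symm.trans_le (hlr u)⟩
  by_cases hu : u ∈ p.support <;> by_cases hv : v ∈ p.support
  · rw [hlS u hu, hlS v hv] at h1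
    have h3 : (s u : ℤ) = s v := mul_right_cancel₀ hN.ne' h1
    exact huv (by rw [← hspine u hu, ← hspine v hv, Int.ofNat_inj.1 h3])
  · rw [hlS u hu, hlL v hv] at h1
    rw [hrS u hu, hrL v hv] at h2
    linarith
  · rw [hlL u hu, hlS v hv] at h1
    rw [hrL u hu, hrS v hv] at h2
    linarith
  · rw [hlL u hu, hlL v hv] at h1
    have h3 : (s u : ℤ) ≤ s v := hdiv (by linarith [hc1 u]) (hcN v) h1.le
    have h4 : (s v : ℤ) ≤ s u := hdiv (by linarith [hc1 v]) (hcN u) h1.ge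
    rw [le_antisymm h3 h4] at h1
    exact huv (hcinj (by linarith))

/-! ### Dimension at most two: interval graphs -/

/-- An interval graph: an intersection graph of order-connected sets of real numbers.
The sets may be empty or unbounded, which does not enlarge the class of finite graphs. -/
def IsIntervalGraph {V : Type*} (G : SimpleGraph V) : Prop :=
  ∃ I : V → Set ℝ, (∀ v, (I v).OrdConnected) ∧
    ∀ u v, u ≠ v → (G.Adj u v ↔ (I u ∩ I v).Nonempty)

/-- In dimension one or two, ordering the minimal points by the difference of their two coordinates
makes the minimal points below a given point consecutive. -/
theorem IsPocRealizable.isIntervalGraph {V : Type*} [Finite V] {G : SimpleGraph V} {d : ℕ}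
    (hd : d ≠ 0) (hd2 : d ≤ 2) (hG : IsPocRealizable G d) : IsIntervalGraph G := by
  obtain ⟨k, D, hD, hGD⟩ := hG
  rw [IsDPartialOrder, if_neg hd] at hD
  obtain ⟨S, ⟨e⟩⟩ := hD
  -- In dimension one both indices are `0`.
  obtain ⟨a, b, hab⟩ : ∃ a b : Fin d, ∀ i, i = a ∨ i = b := by
    refine ⟨⟨0, by omega⟩, ⟨d - 1, by omega⟩, fun i => ?_⟩
    simp only [Fin.ext_iff]
    omega
  let x : V ⊕ Fin k → ℝ := fun w => (e w : Fin d → ℝ) a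
  let y : V ⊕ Fin k → ℝ := fun w => (e w : Fin d → ℝ) b
  have hDadj : ∀ w z, D.Adj w z ↔ x z < x w ∧ y z < y w := by
    intro w z
    rw [← e.map_rel_iff]
    constructor
    · exact fun h => ⟨h a, h b⟩
    · rintro ⟨h1, h2⟩ i
      rcases hab i with rfl | rfl
      exacts [h1, h2]
  let M : Set (V ⊕ Fin k) := {z | ∀ w, ¬ D.Adj z w}
  have hM : ∀ z, ∃ m ∈ M, x m ≤ x z ∧ y m ≤ y z := by
    intro z
    -- A point below `z` of least first coordinate is minimal.
    obtain ⟨m, hm, hmin⟩ := Set.exists_min_image {w | x w ≤ x z ∧ y w ≤ y z} x (Set.toFinite _)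
      ⟨z, le_rfl, le_rfl⟩
    refine ⟨m, fun w hw => ?_, hm⟩
    rw [hDadj] at hw
    exact (hmin w ⟨hw.1.le.trans hm.1, hw.2.le.trans hm.2⟩).not_gt hw.1
  let f : V ⊕ Fin k → ℝ := fun z => x z - y z
  have hconvex : ∀ u, ∀ z ∈ M, ∀ m ∈ M, ∀ z' ∈ M, D.Adj u z → D.Adj u z' → f z ≤ f m →
      f m ≤ f z' → D.Adj u m := by
    intro u z hz m hm z' hz' h h' h1 h2
    rw [hDadj] at h h' ⊢
    have h3 := hm z
    have h4 := hz m
    have h5 := hm z'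
    have h6 := hz' m
    simp only [hDadj, not_and_or, not_lt] at h3 h4 h5 h6
    simp only [f] at h1 h2
    constructor
    · by_contra! hlt
      rcases h5 with h5 | h5 <;> linarith
    · by_contra! hlt
      rcases h3 with h3 | h3 <;> linarith
  have hcommon : ∀ u v, u ≠ v →
      (G.Adj u v ↔ ∃ m ∈ M, D.Adj (Sum.inl u) m ∧ D.Adj (Sum.inl v) m) := by
    intro u v huv
    rw [← SimpleGraph.sum_adj_inl (H := (⊥ : SimpleGraph (Fin k))), hGD]
    constructor
    · rintro ⟨-, z, hu, hv⟩
      obtain ⟨m, hm, hx, hy⟩ := hM z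
      rw [hDadj] at hu hv
      exact ⟨m, hm, (hDadj _ _).2 ⟨by linarith, by linarith⟩,
        (hDadj _ _).2 ⟨by linarith, by linarith⟩⟩
    · rintro ⟨m, -, hu, hv⟩
      exact ⟨Sum.inl_injective.ne huv, m, hu, hv⟩
  refine ⟨fun v => {t | ∃ z ∈ M, ∃ z' ∈ M, D.Adj (Sum.inl v) z ∧ D.Adj (Sum.inl v) z' ∧
    f z ≤ t ∧ t ≤ f z'}, ?_, ?_⟩
  · refine fun v => ⟨?_⟩
    rintro t ⟨z, hz, -, -, hvz, -, hzt, -⟩ t' ⟨-, -, z', hz', -, hvz', -, htz'⟩ r ⟨hr, hr'⟩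
    exact ⟨z, hz, z', hz', hvz, hvz', hzt.trans hr, hr'.trans htz'⟩
  · intro u v huv
    rw [hcommon u v huv]
    constructor
    · rintro ⟨m, hm, hu, hv⟩
      exact ⟨f m, ⟨m, hm, m, hm, hu, hu, le_rfl, le_rfl⟩, m, hm, m, hm, hv, hv, le_rfl, le_rfl⟩
    · rintro ⟨t, ⟨z, hz, z', hz', huz, huz', hzt, htz'⟩, w, hw, w', hw', hvw, hvw', hwt, htw'⟩
      rcases le_total (f z) (f w) with h | h
      · exact ⟨w, hw, hconvex _ z hz w hw z' hz' huz huz' h (hwt.trans htz'), hvw⟩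
      · exact ⟨z, hz, huz, hconvex _ w hw z hz w' hw' hvw hvw' h (hzt.trans htw')⟩

/-! ### Subdivided claws -/

/-- The vertices `c`, `a i`, `b i` span an induced subdivided claw, up to adjacencies and equalities
among the `a i` and among the `b i`: each leg is a path `c`, `a i`, `b i`, and its end `b i` is
neither equal nor adjacent to `c` or to a vertex `a j` of another leg. -/
structure IsSubdividedClaw {V : Type*} (G : SimpleGraph V) (c : V) (a b : Fin 3 → V) : Prop where
  center_adj : ∀ i, G.Adj c (a i)
  leg_adj : ∀ i, G.Adj (a i) (b i)
  ne_center : ∀ i, b i ≠ c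
  not_adj_center : ∀ i, ¬ G.Adj (b i) c
  ne_leg : ∀ i j, i ≠ j → b i ≠ a j
  not_adj_leg : ∀ i j, i ≠ j → ¬ G.Adj (b i) (a j)

/-- The three leaves of a subdivided claw form an asteroidal triple: the interval of one of them
would separate the intervals of the other two, but they are joined by a path avoiding its
neighbours. -/
theorem IsIntervalGraph.not_subdividedClaw {V : Type*} {G : SimpleGraph V} (hG : IsIntervalGraph G)
    {c : V} {a b : Fin 3 → V} (h : IsSubdividedClaw G c a b) : False := by
  obtain ⟨I, hI, hadj⟩ := hG
  have hz : ∀ i, ∃ z, z ∈ I c ∧ z ∈ I (a i) := fun i =>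
    (hadj _ _ (h.center_adj i).ne).1 (h.center_adj i)
  have hy : ∀ i, ∃ y, y ∈ I (a i) ∧ y ∈ I (b i) := fun i =>
    (hadj _ _ (h.leg_adj i).ne).1 (h.leg_adj i)
  choose z hzc hza using hz
  choose y hya hyb using hy
  have hyc : ∀ i, y i ∉ I c := fun i hi =>
    h.not_adj_center i ((hadj _ _ (h.ne_center i)).2 ⟨y i, hyb i, hi⟩)
  have hyn : ∀ i j, i ≠ j → y i ∉ I (a j) := fun i j hij hi =>
    h.not_adj_leg i j hij ((hadj _ _ (h.ne_leg i j hij)).2 ⟨y i, hyb i, hi⟩)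
  -- The points `y i`, `z i`, `z k`, `y k` are consecutively joined by `I (a i)`, `I c`, `I (a k)`.
  have key : ∀ i j k, j ≠ i → j ≠ k → y i ≤ y j → y j ≤ y k → False := by
    intro i j k hji hjk h1 h2
    rcases le_total (y j) (z i) with h3 | h3
    · exact hyn j i hji ((hI _).out (hya i) (hza i) ⟨h1, h3⟩)
    rcases le_total (y j) (z k) with h4 | h4
    · exact hyc j ((hI _).out (hzc i) (hzc k) ⟨h3, h4⟩)
    · exact hyn j k hjk ((hI _).out (hza k) (hya k) ⟨h4, h2⟩)
  rcases le_total (y 0) (y 1) with h01 | h01 <;> rcases le_total (y 1) (y 2) with h12 | h12 <;>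
    rcases le_total (y 0) (y 2) with h02 | h02
  · exact key 0 1 2 (by decide) (by decide) h01 h12
  · exact key 0 1 2 (by decide) (by decide) h01 h12
  · exact key 0 2 1 (by decide) (by decide) h02 h12
  · exact key 2 0 1 (by decide) (by decide) h02 h01
  · exact key 1 0 2 (by decide) (by decide) h01 h02
  · exact key 1 2 0 (by decide) (by decide) h12 h02
  · exact key 2 1 0 (by decide) (by decide) h12 h01
  · exact key 2 1 0 (by decide) (by decide) h12 h01

theorem SimpleGraph.IsAcyclic.not_adj_of_adj_of_adj {V : Type*} {G : SimpleGraph V}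
    (hG : G.IsAcyclic) {x y z : V} (hxy : G.Adj x y) (hyz : G.Adj y z) : ¬ G.Adj x z := by
  intro hxz
  have h := hG.eq_snd_of_adj_start (p := .cons hxy (.cons hyz .nil)) (w := z)
    (by simp [hxy.ne, hyz.ne, hxz.ne]) hxz (by simp)
  exact hyz.ne' (by simpa using h)

/-- An acyclic graph has no cycle of length four. -/
theorem SimpleGraph.IsAcyclic.eq_of_common_neighbors {V : Type*} {G : SimpleGraph V}
    (hG : G.IsAcyclic) {w x y z : V} (hwx : G.Adj w x) (hxy : G.Adj x y) (hwz : G.Adj w z)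
    (hzy : G.Adj z y) (hwy : w ≠ y) : x = z := by
  have h := (hG.subsingleton_path w y).elim
    ⟨.cons hwx (.cons hxy .nil), by simp [hwx.ne, hxy.ne, hwy]⟩
    ⟨.cons hwz (.cons hzy .nil), by simp [hwz.ne, hzy.ne, hwy]⟩
  simpa using congrArg (fun p : G.Path w y => (p : G.Walk w y).snd) h

theorem SimpleGraph.IsAcyclic.isSubdividedClaw {V : Type*} {G : SimpleGraph V} (hG : G.IsAcyclic)
    {c : V} {a b : Fin 3 → V} (hca : ∀ i, G.Adj c (a i)) (hab : ∀ i, G.Adj (a i) (b i))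
    (hbc : ∀ i, b i ≠ c) (ha : Function.Injective a) : IsSubdividedClaw G c a b where
  center_adj := hca
  leg_adj := hab
  ne_center := hbc
  not_adj_center i h := hG.not_adj_of_adj_of_adj (hab i) h (hca i).symm
  ne_leg i j _ h := hG.not_adj_of_adj_of_adj (hca i) (h ▸ hab i) (hca j)
  not_adj_leg i j hij h :=
    hij (ha (hG.eq_of_common_neighbors (hab i).symm (hca i).symm h (hca j).symm (hbc i)))

/-- A finite tree that is not a caterpillar has a vertex at distance two from a longest path. It is
reached from an interior vertex of the path, which by maximality has two further vertices of the
path on either side. -/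
theorem SimpleGraph.IsTree.exists_subdividedClaw {V : Type*} [Finite V] {T : SimpleGraph V}
    (hT : T.IsTree) (hcat : ¬ IsCaterpillar T) : ∃ c a b, IsSubdividedClaw T c a b := by
  have := hT.connected.nonempty
  obtain ⟨s, t, p, hp, hmax⟩ := SimpleGraph.Walk.exists_isPath_forall_isPath_length_le_length T
  have hfar : ∃ w, ¬ ∃ x ∈ p.support, w = x ∨ T.Adj w x := by
    by_contra! h
    exact hcat ⟨hT, s, t, p, hp, h⟩
  obtain ⟨w₀, hw₀⟩ := hfar
  obtain ⟨q⟩ := hT.connected s w₀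
  obtain ⟨⟨⟨v, w⟩, hvw⟩, -, hv, hw⟩ := q.exists_boundary_dart
    {w | ∃ x ∈ p.support, w = x ∨ T.Adj w x} ⟨s, p.start_mem_support, Or.inl rfl⟩ hw₀
  dsimp only at hv hw hvw
  have hwp : w ∉ p.support := fun h => hw ⟨w, h, Or.inl rfl⟩
  have hvp : v ∉ p.support := fun h => hw ⟨v, h, Or.inr hvw.symm⟩
  obtain ⟨x, hx, hvx⟩ := hv
  have hvx : T.Adj v x := hvx.resolve_left fun h => hvp (h ▸ hx)
  obtain ⟨i, rfl, hi⟩ := SimpleGraph.Walk.mem_support_iff_exists_getVert.1 hx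
  have hright : i + 2 ≤ p.length := by
    have hsub : (p.take i).support ⊆ p.support := (p.isSubwalk_take i).support_subset
    have h := hmax _ _ (((p.take i).concat hvx.symm).concat hvw)
      (((hp.take i).concat (fun h => hvp (hsub h)) _).concat (by
        simp only [SimpleGraph.Walk.support_concat, List.mem_append,
          List.mem_singleton, not_or]
        exact ⟨fun h => hwp (hsub h), hvw.ne'⟩) _)
    simp only [SimpleGraph.Walk.length_concat, SimpleGraph.Walk.take_length] at h
    omega
  have hleft : 2 ≤ i := by
    have hsub : (p.drop i).support ⊆ p.support := (p.isSubwalk_drop i).support_subset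
    have h := hmax _ _ (((p.drop i).cons hvx).cons hvw.symm)
      (((hp.drop i).cons (fun h => hvp (hsub h))).cons (by
        simp only [SimpleGraph.Walk.support_cons, List.mem_cons, not_or]
        exact ⟨hvw.ne', fun h => hwp (hsub h)⟩))
    simp only [SimpleGraph.Walk.length_cons, SimpleGraph.Walk.drop_length] at h
    omega
  obtain ⟨j, rfl⟩ : ∃ j, i = j + 2 := ⟨i - 2, by omega⟩
  have hne : ∀ m n, m ≤ p.length → n ≤ p.length → m ≠ n → p.getVert m ≠ p.getVert n :=
    fun m n hm hn hmn h => hmn (hp.getVert_injOn hm hn h)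
  have hmem : ∀ n, p.getVert n ∈ p.support := fun n => p.getVert_mem_support n
  refine ⟨p.getVert (j + 2), ![p.getVert (j + 1), p.getVert (j + 3), v],
    ![p.getVert j, p.getVert (j + 4), w], hT.isAcyclic.isSubdividedClaw ?_ ?_ ?_ ?_⟩
  · simp only [Fin.forall_fin_succ]
    exact ⟨(p.adj_getVert_succ (by omega)).symm, p.adj_getVert_succ (by omega), hvx.symm, by simp⟩
  · simp only [Fin.forall_fin_succ]
    exact ⟨(p.adj_getVert_succ (by omega)).symm, p.adj_getVert_succ (by omega), hvw, by simp⟩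
  · simp only [Fin.forall_fin_succ]
    exact ⟨hne _ _ (by omega) (by omega) (by omega), hne _ _ (by omega) (by omega) (by omega),
      fun h : w = _ => hwp (h ▸ hx), by simp⟩
  · have h13 := hne (j + 1) (j + 3) (by omega) (by omega) (by omega)
    have h1v : p.getVert (j + 1) ≠ v := fun h => hvp (h ▸ hmem _)
    have h3v : p.getVert (j + 3) ≠ v := fun h => hvp (h ▸ hmem _)
    intro m n
    fin_cases m <;> fin_cases n <;> simp [h13, h1v, h3v, h13.symm, h1v.symm, h3v.symm]

/-! ### The dimension of a tree -/

theorem SimpleGraph.IsTree.not_isPocRealizable_of_lt_three {V : Type*} [Finite V]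
    {T : SimpleGraph V} (hT : T.IsTree) (hcat : ¬ IsCaterpillar T) {d : ℕ} (hd : d < 3) :
    ¬ IsPocRealizable T d := by
  obtain ⟨c, a, b, h⟩ := hT.exists_subdividedClaw hcat
  intro hG
  by_cases hd0 : d = 0
  · -- A `0`-partial order has a single vertex, but `c` and `a 0` are distinct.
    subst hd0
    obtain ⟨k, D, hD, -⟩ := hG
    rw [IsDPartialOrder, if_pos rfl] at hD
    have := (Nat.card_eq_one_iff_unique.1 hD).1
    exact (h.center_adj 0).ne (Sum.inl_injective (Subsingleton.elim (α := V ⊕ Fin k) _ _))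
  · exact (hG.isIntervalGraph hd0 (by omega)).not_subdividedClaw h

theorem theorem3p15 {V : Type*} [Finite V] (T : SimpleGraph V) (hT : T.IsTree) :
    dimPoc T ≤ 3 ∧ (dimPoc T = 3 ↔ ¬ IsCaterpillar T) := by
  have h3 : dimPoc T ≤ 3 := iInf₂_le (f := fun (d : ℕ) _ => (d : ℕ∞)) 3 hT.isPocRealizable_three
  refine ⟨h3, fun h hcat => ?_, fun hcat => h3.antisymm (le_iInf₂ fun d hd => ?_)⟩
  · have h2 : dimPoc T ≤ 2 :=
      iInf₂_le (f := fun (d : ℕ) _ => (d : ℕ∞)) 2 hcat.isPocRealizable_two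
    rw [h] at h2
    exact absurd h2 (by decide)
  · by_contra! hlt
    exact hT.not_isPocRealizable_of_lt_three hcat (by exact_mod_cast hlt) hd
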